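/- Let $n\ge 2$, $1\le p<\infty$, $0<s<1$ with $sp<n$, put $p^*_s:=\frac{np}{n-sp}$, and let $1\le q\le r<p^*_s$. Let $K,V:\mathbb R^n\to(0,\infty)$ be Lebesgue measurable, and assume that $\inf_D V>0$ for every compact $D\subset\mathbb R^n$, that for some $t\in\bigl(\frac{p^*_s}{p^*_s-r},\infty\bigr]$ one has $K\in L^t(\Omega)$ for every measurable $\Omega\subset\mathbb R^n$ of finite Lebesgue measure, and that, with $\tau:=\frac{p^*_s-r}{p^*_s-q}$, the function $KV^{-\tau}$ vanishes at infinity, that is, it is locally integrable and $\{x\in\mathbb R^n: K(x)V(x)^{-\tau}\ge c\}$ has finite Lebesgue measure for every $c>0$. Let $M_V^{s;q,p}(\mathbb R^n)$ be the Banach space obtained by completing the space of real-valued $C^1$ functions $u$ with compact support on $\mathbb R^n$ for which $$\|u\|:=\Bigl(\int_{\mathbb R^n}|u|^qV\,dx\Bigr)^{1/q}+\Bigl(\int_{\mathbb R^n}\int_{\mathbb R^n}\frac{|u(x)-u(y)|^p}{|x-y|^{n+sp}}\,dx\,dy\Bigr)^{1/p}$$ is finite, with respect to this norm, and let $L^r(K;\mathbb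 R^n)$ be the Lebesgue space with norm $\bigl(\int_{\mathbb R^n}|u|^rK\,dx\bigr)^{1/r}$. Then $M_V^{s;q,p}(\mathbb R^n)$ embeds compactly into $L^r(K;\mathbb R^n)$: the identity on these $C^1$ functions extends to a continuous injective linear map $M_V^{s;q,p}(\mathbb R^n)\to L^r(K;\mathbb R^n)$, and this map is a compact operator. -/

import Mathlib

open MeasureTheory
open scoped ENNReal

namespace FracSobolev

instance fact_one_le_ofReal (p : ℝ) [h : Fact (1 ≤ p)] : Fact (1 ≤ ENNReal.ofReal p) :=
  ⟨by simpa using h.out⟩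

/-- The critical exponent `p*_s = np / (n - sp)`. -/
noncomputable def critExp (n : ℕ) (s p : ℝ) : ℝ := n * p / (n - s * p)

/-- The measure `w(x) dx` on `ℝⁿ`. -/
noncomputable def weightMeasure {n : ℕ} (w : EuclideanSpace ℝ (Fin n) → ℝ) :
    Measure (EuclideanSpace ℝ (Fin n)) :=
  volume.withDensity fun x => ENNReal.ofReal (w x)

/-- The Gagliardo seminorm
`[u]_{s,p} = (∬ |u(x) - u(y)|^p / |x - y|^(n + sp) dx dy)^(1/p)`, with values in `[0, ∞]`. -/
noncomputable def gagliardo {n : ℕ} (s p : ℝ) (u : EuclideanSpace ℝ (Fin n) → ℝ) : ℝ≥0∞ :=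
  (∫⁻ z : EuclideanSpace ℝ (Fin n) × EuclideanSpace ℝ (Fin n),
    ENNReal.ofReal (|u z.1 - u z.2| ^ p / ‖z.1 - z.2‖ ^ ((n : ℝ) + s * p))) ^ (1 / p)

/-- A locally integrable function `f` vanishes at infinity when each set `{|f| ≥ c}`, `c > 0`,
has finite Lebesgue measure. -/
def VanishesAtInfinity {n : ℕ} (f : EuclideanSpace ℝ (Fin n) → ℝ) : Prop :=
  LocallyIntegrable f volume ∧ ∀ c : ℝ, 0 < c → volume {x | c ≤ |f x|} < ∞

/-- The Gagliardo seminorm is the `L^p` norm of a difference quotient on `ℝⁿ × ℝⁿ`. -/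
theorem gagliardo_eq_eLpNorm {n : ℕ} (s p : ℝ) [hp : Fact (1 ≤ p)]
    (u : EuclideanSpace ℝ (Fin n) → ℝ) :
    gagliardo s p u =
      eLpNorm (fun z : EuclideanSpace ℝ (Fin n) × EuclideanSpace ℝ (Fin n) =>
        (u z.1 - u z.2) / ‖z.1 - z.2‖ ^ (((n : ℝ) + s * p) / p)) (ENNReal.ofReal p) volume := by
  have hp0 : 0 < p := lt_of_lt_of_le one_pos hp.out
  rw [eLpNorm_eq_lintegral_rpow_enorm_toReal (by simpa using hp0) ENNReal.ofReal_ne_top,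
    ENNReal.toReal_ofReal hp0.le, gagliardo]
  congr 1
  refine lintegral_congr fun z => ?_
  rw [← ofReal_norm, ENNReal.ofReal_rpow_of_nonneg (norm_nonneg _) hp0.le, norm_div,
    Real.div_rpow (norm_nonneg _) (norm_nonneg _), Real.norm_eq_abs,
    Real.norm_of_nonneg (Real.rpow_nonneg (norm_nonneg _) _),
    ← Real.rpow_mul (norm_nonneg _), div_mul_cancel₀ _ hp0.ne']

theorem aestronglyMeasurable_quotient {n : ℕ} (a : ℝ) {u : EuclideanSpace ℝ (Fin n) → ℝ}
    (hu : Continuous u) :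
    AEStronglyMeasurable (fun z : EuclideanSpace ℝ (Fin n) × EuclideanSpace ℝ (Fin n) =>
      (u z.1 - u z.2) / ‖z.1 - z.2‖ ^ a) volume := by
  have := hu.measurable
  exact Measurable.aestronglyMeasurable (by fun_prop)

theorem gagliardo_add_le {n : ℕ} (s p : ℝ) [Fact (1 ≤ p)]
    {u v : EuclideanSpace ℝ (Fin n) → ℝ} (hu : Continuous u) (hv : Continuous v) :
    gagliardo s p (u + v) ≤ gagliardo s p u + gagliardo s p v := by
  simp only [gagliardo_eq_eLpNorm]
  refine le_trans (le_of_eq ?_) (eLpNorm_add_le (aestronglyMeasurable_quotient _ hu)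
    (aestronglyMeasurable_quotient _ hv) (fact_one_le_ofReal p).out)
  congr 1
  funext z
  simp only [Pi.add_apply]
  ring

theorem gagliardo_smul {n : ℕ} (s p : ℝ) [Fact (1 ≤ p)] (c : ℝ)
    (u : EuclideanSpace ℝ (Fin n) → ℝ) :
    gagliardo s p (c • u) = ‖c‖ₑ * gagliardo s p u := by
  simp only [gagliardo_eq_eLpNorm]
  rw [← eLpNorm_const_smul]
  congr 1
  funext z
  simp only [Pi.smul_apply, smul_eq_mul]
  ring

/-- The `C¹` functions `u` with compact support on `ℝⁿ` for which `‖u‖_{L^q(V)} + [u]_{s,p}` is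
finite. For `V` locally integrable and `0 < s < 1` these are all of `C¹_c(ℝⁿ)`. -/
def testSubmodule (n : ℕ) (s q p : ℝ) [Fact (1 ≤ q)] [Fact (1 ≤ p)]
    (V : EuclideanSpace ℝ (Fin n) → ℝ) : Submodule ℝ (EuclideanSpace ℝ (Fin n) → ℝ) where
  carrier := {u | ContDiff ℝ 1 u ∧ HasCompactSupport u ∧
    eLpNorm u (ENNReal.ofReal q) (weightMeasure V) < ∞ ∧ gagliardo s p u < ∞}
  zero_mem' := by
    refine ⟨contDiff_const, HasCompactSupport.zero, by simp, ?_⟩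
    simp [gagliardo_eq_eLpNorm]
  add_mem' := by
    rintro u v ⟨hu, hu', hu1, hu2⟩ ⟨hv, hv', hv1, hv2⟩
    exact ⟨hu.add hv, hu'.add hv',
      (eLpNorm_add_le hu.continuous.aestronglyMeasurable hv.continuous.aestronglyMeasurable
        (fact_one_le_ofReal q).out).trans_lt (ENNReal.add_lt_top.2 ⟨hu1, hv1⟩),
      (gagliardo_add_le s p hu.continuous hv.continuous).trans_lt
        (ENNReal.add_lt_top.2 ⟨hu2, hv2⟩)⟩
  smul_mem' := by
    rintro c u ⟨hu, hu', hu1, hu2⟩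
    refine ⟨contDiff_const.smul hu, hu'.smul_left, ?_, ?_⟩
    · rw [eLpNorm_const_smul]
      exact ENNReal.mul_lt_top enorm_lt_top hu1
    · rw [gagliardo_smul]
      exact ENNReal.mul_lt_top enorm_lt_top hu2

/-- The vector space of test functions, to be normed by `‖u‖_{L^q(V)} + [u]_{s,p}`. -/
def TestSpace (n : ℕ) (s q p : ℝ) [Fact (1 ≤ q)] [Fact (1 ≤ p)]
    (V : EuclideanSpace ℝ (Fin n) → ℝ) : Type :=
  testSubmodule n s q p V

section

variable (n : ℕ) (s q p : ℝ) [Fact (1 ≤ q)] [Fact (1 ≤ p)] (V : EuclideanSpace ℝ (Fin n) → ℝ)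

instance : AddCommGroup (TestSpace n s q p V) :=
  inferInstanceAs (AddCommGroup (testSubmodule n s q p V))

instance : Module ℝ (TestSpace n s q p V) :=
  inferInstanceAs (Module ℝ (testSubmodule n s q p V))

/-- A test function as a function on `ℝⁿ`. -/
instance : CoeFun (TestSpace n s q p V) (fun _ => EuclideanSpace ℝ (Fin n) → ℝ) :=
  ⟨Subtype.val⟩

/-- The norm `‖u‖_{L^q(V)} + [u]_{s,p}` on test functions. -/
noncomputable instance : Norm (TestSpace n s q p V) :=
  ⟨fun u => (eLpNorm u (ENNReal.ofReal q) (weightMeasure V)).toReal + (gagliardo s p u).toReal⟩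

theorem norm_def (u : TestSpace n s q p V) :
    ‖u‖ = (eLpNorm u (ENNReal.ofReal q) (weightMeasure V)).toReal + (gagliardo s p u).toReal :=
  rfl

theorem seminormCore : SeminormedSpace.Core ℝ (TestSpace n s q p V) where
  norm_nonneg u := add_nonneg ENNReal.toReal_nonneg ENNReal.toReal_nonneg
  norm_smul c u := by
    change (eLpNorm (c • u.1) _ _).toReal + (gagliardo s p (c • u.1)).toReal = _
    rw [eLpNorm_const_smul, gagliardo_smul, ENNReal.toReal_mul, ENNReal.toReal_mul, toReal_enorm,
      ← mul_add, norm_def]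
  norm_triangle u v := by
    obtain ⟨hu, -, hu1, hu2⟩ := u.2
    obtain ⟨hv, -, hv1, hv2⟩ := v.2
    change (eLpNorm (u.1 + v.1) _ _).toReal + (gagliardo s p (u.1 + v.1)).toReal ≤ _
    have h1 := ENNReal.toReal_mono (ENNReal.add_lt_top.2 ⟨hu1, hv1⟩).ne
      (eLpNorm_add_le hu.continuous.aestronglyMeasurable hv.continuous.aestronglyMeasurable
        (fact_one_le_ofReal q).out)
    have h2 := ENNReal.toReal_mono (ENNReal.add_lt_top.2 ⟨hu2, hv2⟩).ne
      (gagliardo_add_le s p hu.continuous hv.continuous)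
    rw [ENNReal.toReal_add hu1.ne hv1.ne] at h1
    rw [ENNReal.toReal_add hu2.ne hv2.ne] at h2
    rw [norm_def, norm_def]
    linarith

noncomputable instance : SeminormedAddCommGroup (TestSpace n s q p V) :=
  SeminormedAddCommGroup.ofCore (seminormCore n s q p V)

noncomputable instance : NormedSpace ℝ (TestSpace n s q p V) where
  norm_smul_le c u := ((seminormCore n s q p V).norm_smul c u).le

/-- The Banach space `M_V^{s;q,p}(ℝⁿ)`: the completion of the space of test functions with respect
to `‖u‖_{L^q(V)} + [u]_{s,p}`. -/
abbrev MSpace : Type := UniformSpace.Completion (TestSpace n s q p V)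

end

/-- The weighted Lebesgue space `L^r(K; ℝⁿ)`, with norm `(∫ |u|^r K dx)^(1/r)`. -/
noncomputable abbrev WeightedLp {n : ℕ} (r : ℝ) (K : EuclideanSpace ℝ (Fin n) → ℝ) : Type :=
  Lp ℝ (ENNReal.ofReal r) (weightMeasure K)

end FracSobolev

/-!
The proof rests on comparing a function with its averages over balls. Let
`G(x) = ∫ |u(x) - u(y)|^p / |x - y|^(n + sp) dy`, so that the integral of `G` is the `p`-th power of
the Gagliardo seminorm. By Jensen's inequality, if `x` lies within `d` of all points of a ball of
radius `ρ`, the average `m` of `u` over that ball satisfies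
`|u(x) - m|^p ≤ C d^(n + sp) ρ^(-n) G(x)` (`enorm_sub_setAverage_rpow_le`). This is used twice.

* For balls centred at `x`, Hölder's inequality bounds the average by `C ρ^(-n/p*) ‖u‖_{p*}`.
  Optimising in `ρ` gives `|u|^{p*} ≤ C G ‖u‖_{p*}^{p* - p}`, and integration gives the fractional
  Sobolev inequality `‖u‖_{p*} ≤ C [u]_{s,p}` (`exists_eLpNorm_critExp_le`), for `p = 1` as well.
* For balls whose centres run through a fixed dense sequence, it shows that on a set of finite measure
  a function of bounded seminorm is close to finitely many of its averages, off a set of small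
  measure.

The weights enter through two estimates. Since `r = τ q + (1 - τ) p*`, on a set where `K ≤ c V^τ` the
integral of `|u|^r K` is at most `c (∫ |u|^q V)^τ (∫ |u|^{p*})^(1 - τ)`, and the complement of such a
set has finite measure because `K V^(-τ)` vanishes at infinity. On a set `A` of finite measure,
Hölder's inequality bounds the integral by `‖u‖_{p*}^r` times a power of the integral of
`K^(p* / (p* - r))` over `A`, which is finite by the hypothesis on `t` and small when `A` is small.

Together these bound the embedding on test functions (`exists_lintegral_mul_le`) and show that, on
bounded sets, its norm is controlled by finitely many averages (`exists_averages_control`); rounding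
these averages shows that the image of a ball is totally bounded. Injectivity of the extension follows
from Fatou's lemma: a Cauchy sequence of test functions that tends to zero in `L^r(K)` has a
subsequence tending to zero almost everywhere, and along it both parts of the norm tend to zero.
-/

namespace FracSobolev

/-! ### The Gagliardo density and averages -/

/-- The inner integral `∫ |u(x) - u(y)|^p / |x - y|^(n + sp) dy` of the Gagliardo seminorm. -/
noncomputable def gagliardoDensity {n : ℕ} (s p : ℝ) (u : EuclideanSpace ℝ (Fin n) → ℝ)
    (x : EuclideanSpace ℝ (Fin n)) : ℝ≥0∞ :=
  ∫⁻ y, ENNReal.ofReal (|u x - u y| ^ p / ‖x - y‖ ^ ((n : ℝ) + s * p))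

section

variable {n : ℕ} {s p : ℝ} {u : EuclideanSpace ℝ (Fin n) → ℝ}

theorem measurable_gagliardo_integrand (hu : Continuous u) :
    Measurable fun z : EuclideanSpace ℝ (Fin n) × EuclideanSpace ℝ (Fin n) =>
      ENNReal.ofReal (|u z.1 - u z.2| ^ p / ‖z.1 - z.2‖ ^ ((n : ℝ) + s * p)) := by
  have := hu.measurable
  fun_prop

theorem measurable_gagliardoDensity (hu : Continuous u) :
    Measurable (gagliardoDensity s p u) :=
  (measurable_gagliardo_integrand hu).lintegral_prod_right'

theorem lintegral_gagliardoDensity (hp : 0 < p) (hu : Continuous u) :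
    ∫⁻ x, gagliardoDensity s p u x = gagliardo s p u ^ p := by
  rw [gagliardo, ← ENNReal.rpow_mul, one_div, inv_mul_cancel₀ hp.ne', ENNReal.rpow_one,
    Measure.volume_eq_prod, lintegral_prod _ (measurable_gagliardo_integrand hu).aemeasurable]
  rfl

/-- Jensen's inequality for the power function, on a set of finite measure. -/
theorem rpow_lintegral_le {α : Type*} [MeasurableSpace α] {μ : Measure α} (hp : 1 ≤ p)
    {f : α → ℝ≥0∞} (hf : AEMeasurable f μ) :
    (∫⁻ x, f x ∂μ) ^ p ≤ (∫⁻ x, f x ^ p ∂μ) * μ Set.univ ^ (p - 1) := by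
  have hp0 : 0 < p := by linarith
  have h := ENNReal.lintegral_mul_norm_pow_le (hf.pow_const p) (aemeasurable_const (b := (1 : ℝ≥0∞)))
    (inv_nonneg.2 hp0.le) (sub_nonneg.2 (inv_le_one_of_one_le₀ hp)) (add_sub_cancel _ _)
  simp only [← ENNReal.rpow_mul, mul_inv_cancel₀ hp0.ne', ENNReal.rpow_one, ENNReal.one_rpow,
    mul_one, lintegral_const, one_mul] at h
  refine (ENNReal.rpow_le_rpow h hp0.le).trans_eq ?_
  rw [ENNReal.mul_rpow_of_nonneg _ _ hp0.le, ← ENNReal.rpow_mul, ← ENNReal.rpow_mul,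
    inv_mul_cancel₀ hp0.ne', ENNReal.rpow_one, sub_mul, inv_mul_cancel₀ hp0.ne', one_mul]

theorem enorm_sub_setAverage_le {Q : Set (EuclideanSpace ℝ (Fin n))}
    (hQ0 : volume Q ≠ 0) (hQ : volume Q ≠ ∞) (hu : IntegrableOn u Q) (c : ℝ) :
    ‖c - ⨍ y in Q, u y‖ₑ ≤ (∫⁻ y in Q, ‖c - u y‖ₑ) / volume Q := by
  have hpos : 0 < volume.real Q := ENNReal.toReal_pos hQ0 hQ
  have h : ∫ y in Q, (c - u y) = volume.real Q * (c - ⨍ y in Q, u y) := by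
    have hc : IntegrableOn (fun _ => c) Q := integrableOn_const hQ
    rw [integral_sub hc.integrable hu.integrable, setAverage_eq, setIntegral_const]
    simp only [smul_eq_mul]
    field_simp
  have h2 := enorm_integral_le_lintegral_enorm (μ := volume.restrict Q) fun y => c - u y
  rw [h, enorm_mul, Real.enorm_of_nonneg hpos.le, Measure.real, ENNReal.ofReal_toReal hQ] at h2
  rwa [ENNReal.le_div_iff_mul_le (Or.inl hQ0) (Or.inl hQ), mul_comm]

/-- On a set `Q` within distance `d` of `x`, the Gagliardo density at `x` controls the deviation of
`u x` from the average of `u` over `Q`. -/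
theorem enorm_sub_setAverage_rpow_le (hp : 1 ≤ p) (hs : 0 ≤ s) (hu : Continuous u)
    {Q : Set (EuclideanSpace ℝ (Fin n))} (hQm : MeasurableSet Q)
    (hQ0 : volume Q ≠ 0) (hQ : volume Q ≠ ∞) (huQ : IntegrableOn u Q)
    (x : EuclideanSpace ℝ (Fin n)) {d : ℝ} (hd : ∀ y ∈ Q, ‖x - y‖ ≤ d) :
    ‖u x - ⨍ y in Q, u y‖ₑ ^ p ≤
      ENNReal.ofReal (d ^ ((n : ℝ) + s * p)) / volume Q * gagliardoDensity s p u x := by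
  have hp0 : 0 < p := by linarith
  have hmeas : AEMeasurable (fun y => ‖u x - u y‖ₑ) (volume.restrict Q) := by
    have := hu.measurable
    exact Measurable.aemeasurable (by fun_prop)
  have hpt : ∀ y ∈ Q, ‖u x - u y‖ₑ ^ p ≤ ENNReal.ofReal (d ^ ((n : ℝ) + s * p)) *
      ENNReal.ofReal (|u x - u y| ^ p / ‖x - y‖ ^ ((n : ℝ) + s * p)) := by
    intro y hy
    have hd0 : 0 ≤ d := (norm_nonneg _).trans (hd y hy)
    rw [← ofReal_norm, ENNReal.ofReal_rpow_of_nonneg (norm_nonneg _) hp0.le,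
      ← ENNReal.ofReal_mul (by positivity), Real.norm_eq_abs]
    refine ENNReal.ofReal_le_ofReal ?_
    rcases eq_or_ne x y with rfl | hxy
    · rw [sub_self, abs_zero, Real.zero_rpow hp0.ne']
      positivity
    have hpos : 0 < ‖x - y‖ := norm_pos_iff.2 (sub_ne_zero.2 hxy)
    rw [mul_div_assoc', le_div_iff₀ (by positivity), mul_comm]
    have := Real.rpow_le_rpow hpos.le (hd y hy) (by positivity : 0 ≤ (n : ℝ) + s * p)
    gcongr
  have h1 : (∫⁻ y in Q, ‖u x - u y‖ₑ) ^ p ≤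
      ENNReal.ofReal (d ^ ((n : ℝ) + s * p)) * gagliardoDensity s p u x *
        volume Q ^ (p - 1) := by
    refine (rpow_lintegral_le hp hmeas).trans ?_
    rw [Measure.restrict_apply_univ]
    gcongr
    refine (setLIntegral_mono' hQm hpt).trans ?_
    rw [lintegral_const_mul' _ _ ENNReal.ofReal_ne_top]
    gcongr
    exact setLIntegral_le_lintegral _ _
  refine (ENNReal.rpow_le_rpow (enorm_sub_setAverage_le hQ0 hQ huQ (u x)) hp0.le).trans ?_
  rw [ENNReal.div_rpow_of_nonneg _ _ hp0.le]
  refine (ENNReal.div_le_div_right h1 _).trans_eq ?_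
  rw [ENNReal.rpow_sub _ _ hQ0 hQ, ENNReal.rpow_one, div_eq_mul_inv, div_eq_mul_inv,
    div_eq_mul_inv]
  have : volume Q ^ p * (volume Q ^ p)⁻¹ = 1 := ENNReal.mul_inv_cancel
    (by simp [hQ0, hQ]) (ENNReal.rpow_ne_top_of_nonneg hp0.le hQ)
  calc _ = ENNReal.ofReal (d ^ ((n : ℝ) + s * p)) * gagliardoDensity s p u x * (volume Q)⁻¹ *
        (volume Q ^ p * (volume Q ^ p)⁻¹) := by ring
    _ = _ := by rw [this]; ring

/-- Hölder's inequality for the average over a set of finite measure. -/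
theorem enorm_setAverage_le {P : ℝ} (hP : 1 ≤ P)
    {Q : Set (EuclideanSpace ℝ (Fin n))} (hQ0 : volume Q ≠ 0) (hQ : volume Q ≠ ∞)
    (hu : Continuous u) (huQ : IntegrableOn u Q) :
    ‖⨍ y in Q, u y‖ₑ ≤ volume Q ^ (-P⁻¹) * eLpNorm u (ENNReal.ofReal P) volume := by
  have hP0 : 0 < P := by linarith
  have h := enorm_sub_setAverage_le hQ0 hQ huQ 0
  simp only [zero_sub, enorm_neg] at h
  have h1 := rpow_lintegral_le (μ := volume.restrict Q) hP
    (f := fun y => ‖u y‖ₑ) (by have := hu.measurable; exact Measurable.aemeasurable (by fun_prop))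
  rw [Measure.restrict_apply_univ] at h1
  refine h.trans ((ENNReal.rpow_le_rpow_iff hP0).1 ?_)
  rw [ENNReal.div_rpow_of_nonneg _ _ hP0.le, ENNReal.mul_rpow_of_nonneg _ _ hP0.le,
    eLpNorm_eq_lintegral_rpow_enorm_toReal (by simpa using hP0) ENNReal.ofReal_ne_top,
    ENNReal.toReal_ofReal hP0.le, ← ENNReal.rpow_mul, ← ENNReal.rpow_mul, one_div, neg_mul,
    inv_mul_cancel₀ hP0.ne', ENNReal.rpow_one, ENNReal.rpow_neg_one]
  refine (ENNReal.div_le_div_right h1 _).trans ?_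
  rw [ENNReal.rpow_sub _ _ hQ0 hQ, ENNReal.rpow_one, div_eq_mul_inv, div_eq_mul_inv]
  have : volume Q ^ P * (volume Q ^ P)⁻¹ = 1 := ENNReal.mul_inv_cancel
    (by simp [hQ0, hQ]) (ENNReal.rpow_ne_top_of_nonneg hP0.le hQ)
  calc _ = (volume Q)⁻¹ * (∫⁻ y in Q, ‖u y‖ₑ ^ P) * (volume Q ^ P * (volume Q ^ P)⁻¹) := by ring
    _ ≤ _ := by
      rw [this, mul_one]
      exact mul_le_mul_right (setLIntegral_le_lintegral _ _) _

end

/-! ### The fractional Sobolev inequality -/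

/-- Optimising `a ρ^α f + b ρ^(-β) m` over the scale `ρ > 0`. -/
theorem le_of_forall_scale {x a b f m α β : ℝ}
    (hf : 0 ≤ f) (hm : 0 < m) (hα : 0 < α) (hβ : 0 < β)
    (h : ∀ ρ : ℝ, 0 < ρ → x ≤ a * ρ ^ α * f + b * ρ ^ (-β) * m) :
    x ≤ (a + b) * (f ^ (β / (α + β)) * m ^ (α / (α + β))) := by
  have hαβ : 0 < α + β := by positivity
  rcases hf.eq_or_lt with rfl | hf
  · rw [Real.zero_rpow (by positivity), zero_mul, mul_zero]
    have hlim : Filter.Tendsto (fun ρ : ℝ => b * ρ ^ (-β) * m) Filter.atTop (nhds (b * 0 * m)) :=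
      ((tendsto_rpow_neg_atTop hβ).const_mul b).mul_const m
    rw [mul_zero, zero_mul] at hlim
    refine ge_of_tendsto hlim ?_
    filter_upwards [Filter.eventually_gt_atTop 0] with ρ hρ
    simpa using h ρ hρ
  · -- the two terms balance at `ρ ^ (α + β) = m / f`
    refine (h ((m / f) ^ (α + β)⁻¹) (by positivity)).trans_eq ?_
    rw [← Real.rpow_mul (by positivity), ← Real.rpow_mul (by positivity),
      Real.div_rpow hm.le hf.le, Real.div_rpow hm.le hf.le]
    have e1 : m ^ ((α + β)⁻¹ * α) / f ^ ((α + β)⁻¹ * α) * f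
        = f ^ (β / (α + β)) * m ^ (α / (α + β)) := by
      have : f = f ^ ((α + β)⁻¹ * α) * f ^ (β / (α + β)) := by
        rw [← Real.rpow_add hf, show (α + β)⁻¹ * α + β / (α + β) = 1 by field_simp, Real.rpow_one]
      nth_rw 2 [this]
      rw [show α / (α + β) = (α + β)⁻¹ * α by ring]
      field_simp
    have e2 : m ^ ((α + β)⁻¹ * -β) / f ^ ((α + β)⁻¹ * -β) * m
        = f ^ (β / (α + β)) * m ^ (α / (α + β)) := by
      have : m ^ (α / (α + β)) = m ^ ((α + β)⁻¹ * -β) * m := by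
        nth_rw 3 [← Real.rpow_one m]
        rw [← Real.rpow_add hm]
        congr 1
        field_simp
        ring
      rw [this, show (α + β)⁻¹ * -β = -(β / (α + β)) by ring, Real.rpow_neg hf.le]
      field_simp
    rw [mul_assoc, e1, mul_assoc b, e2]
    ring

theorem ennreal_le_of_forall_scale {X a b F M : ℝ≥0∞} {α β : ℝ} (ha : a ≠ ∞) (hb : b ≠ ∞)
    (ha0 : a ≠ 0) (hM0 : M ≠ 0) (hM : M ≠ ∞) (hα : 0 < α) (hβ : 0 < β)
    (h : ∀ ρ : ℝ, 0 < ρ → X ≤ a * ENNReal.ofReal (ρ ^ α) * F + b * ENNReal.ofReal (ρ ^ (-β)) * M) :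
    X ≤ (a + b) * (F ^ (β / (α + β)) * M ^ (α / (α + β))) := by
  have hαβ : 0 < α + β := by positivity
  rcases eq_or_ne F ∞ with rfl | hF
  · rw [ENNReal.top_rpow_of_pos (by positivity), ENNReal.top_mul, ENNReal.mul_top]
    · exact le_top
    · simp [ha0]
    · simp [hM0, hM]
  have hX : X ≠ ∞ := by
    refine ne_top_of_le_ne_top ?_ (h 1 one_pos)
    finiteness
  lift X to NNReal using hX
  lift F to NNReal using hF
  lift M to NNReal using hM
  lift a to NNReal using ha
  lift b to NNReal using hb
  rw [← ENNReal.coe_rpow_of_nonneg _ (by positivity), ← ENNReal.coe_rpow_of_nonneg _ (by positivity)]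
  norm_cast
  rw [← NNReal.coe_le_coe]
  push_cast
  refine le_of_forall_scale F.2
    (lt_of_le_of_ne M.2 fun h0 => hM0 (by rw [← NNReal.coe_zero, NNReal.coe_inj] at h0; simp [← h0]))
    hα hβ fun ρ hρ => ?_
  have := h ρ hρ
  rw [ENNReal.ofReal, ENNReal.ofReal] at this
  norm_cast at this
  rw [← NNReal.coe_le_coe] at this
  push_cast at this
  rwa [Real.coe_toNNReal _ (by positivity), Real.coe_toNNReal _ (by positivity)] at this

section

variable {n : ℕ} {s p : ℝ}

theorem volume_ball_eq (x : EuclideanSpace ℝ (Fin n)) {ρ : ℝ} (hρ : 0 < ρ) :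
    volume (Metric.ball x ρ) = ENNReal.ofReal (ρ ^ (n : ℝ)) *
      volume (Metric.ball (0 : EuclideanSpace ℝ (Fin n)) 1) := by
  rw [Measure.addHaar_ball_of_pos _ _ hρ, finrank_euclideanSpace, Fintype.card_fin,
    Real.rpow_natCast]

theorem lt_critExp (hs : 0 < s) (hp : 0 < p) (hsp : s * p < n) : p < critExp n s p := by
  rw [critExp, lt_div_iff₀ (by linarith)]
  nlinarith [mul_pos hs hp]

theorem integrableOn_ball {u : EuclideanSpace ℝ (Fin n) → ℝ} (hu : Continuous u)
    (x : EuclideanSpace ℝ (Fin n)) (ρ : ℝ) : IntegrableOn u (Metric.ball x ρ) :=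
  (hu.continuousOn.integrableOn_compact (isCompact_closedBall x ρ)).mono_set
    Metric.ball_subset_closedBall

/-- The fractional Sobolev inequality. For each `ρ` one has
`|u(x)| ≤ a ρ^s G(x)^(1/p) + b ρ^(-n/p*) ‖u‖_{p*}`, by comparing `u(x)` with the average of `u` over
`B(x, ρ)`, where `G` is the Gagliardo density. Optimising in `ρ` gives
`|u(x)|^{p*} ≤ C G(x) ‖u‖_{p*}^{p* - p}`, and integrating this inequality gives the result. -/
theorem exists_eLpNorm_critExp_le (hs : 0 < s) (hp : 1 ≤ p) (hsp : s * p < n) :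
    ∃ C : ℝ≥0∞, C ≠ ∞ ∧ ∀ u : EuclideanSpace ℝ (Fin n) → ℝ, Continuous u → HasCompactSupport u →
      eLpNorm u (ENNReal.ofReal (critExp n s p)) volume ≤ C * gagliardo s p u := by
  have hp0 : 0 < p := by linarith
  have hsp0 : 0 < s * p := by positivity
  have hn : (0 : ℝ) < n := by linarith
  have hnsp : 0 < (n : ℝ) - s * p := by linarith
  have hpP : p < critExp n s p := lt_critExp hs hp0 hsp
  have hP : critExp n s p = n * p / (n - s * p) := rfl
  set P := critExp n s p
  have hP0 : 0 < P := by linarith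
  set ω := volume (Metric.ball (0 : EuclideanSpace ℝ (Fin n)) 1) with hω
  have hω0 : ω ≠ 0 := (Metric.measure_ball_pos _ _ one_pos).ne'
  have hωt : ω ≠ ∞ := measure_ball_lt_top.ne
  set a : ℝ≥0∞ := ω ^ (-p⁻¹) with ha
  set b : ℝ≥0∞ := ω ^ (-P⁻¹) with hb
  have ha0 : a ≠ 0 := by simp [ha, hω0, hωt]
  have hat : a ≠ ∞ := by simp [ha, hω0, hωt]
  have hbt : b ≠ ∞ := by simp [hb, hω0, hωt]
  refine ⟨(a + b) ^ (P / p), by finiteness, fun u hu hcu => ?_⟩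
  set M := eLpNorm u (ENNReal.ofReal P) volume with hM
  have hMt : M ≠ ∞ := (hu.memLp_of_hasCompactSupport hcu).eLpNorm_ne_top
  rcases eq_or_ne M 0 with hM0 | hM0
  · rw [hM0]; exact zero_le
  -- the pointwise estimate at scale `ρ`
  have hscale : ∀ x, ∀ ρ : ℝ, 0 < ρ → ‖u x‖ₑ ≤ a * ENNReal.ofReal (ρ ^ s) *
      gagliardoDensity s p u x ^ p⁻¹ + b * ENNReal.ofReal (ρ ^ (-(n / P))) * M := by
    intro x ρ hρ
    have hv := volume_ball_eq x hρ
    have hv0 : volume (Metric.ball x ρ) ≠ 0 := (Metric.measure_ball_pos _ _ hρ).ne'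
    have hvt : volume (Metric.ball x ρ) ≠ ∞ := measure_ball_lt_top.ne
    have h1 := enorm_sub_setAverage_rpow_le hp hs.le hu measurableSet_ball hv0 hvt
      (integrableOn_ball hu x ρ) x (d := ρ)
      (fun y hy => by rw [← dist_eq_norm, dist_comm]; exact (Metric.mem_ball.1 hy).le)
    have h2 := enorm_setAverage_le (P := P) (by linarith) hv0 hvt hu (integrableOn_ball hu x ρ)
    have h3 : ‖u x‖ₑ ≤ ‖u x - ⨍ y in Metric.ball x ρ, u y‖ₑ + ‖⨍ y in Metric.ball x ρ, u y‖ₑ := by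
      simpa using enorm_add_le (u x - ⨍ y in Metric.ball x ρ, u y) (⨍ y in Metric.ball x ρ, u y)
    refine h3.trans (add_le_add ?_ (h2.trans_eq ?_))
    · refine (ENNReal.rpow_le_rpow_iff hp0).1 (h1.trans_eq ?_)
      rw [hv, ENNReal.mul_rpow_of_nonneg _ _ hp0.le, ENNReal.mul_rpow_of_nonneg _ _ hp0.le, ha,
        ← ENNReal.rpow_mul, ← ENNReal.rpow_mul, neg_mul, inv_mul_cancel₀ hp0.ne', ENNReal.rpow_one,
        ENNReal.rpow_neg_one, ENNReal.ofReal_rpow_of_nonneg (by positivity) hp0.le,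
        ← Real.rpow_mul hρ.le, div_eq_mul_inv, ENNReal.mul_inv (Or.inr hωt) (Or.inr hω0),
        ← mul_assoc, ← ENNReal.ofReal_inv_of_pos (by positivity),
        ← ENNReal.ofReal_mul (by positivity), ← Real.rpow_neg hρ.le, ← Real.rpow_add hρ]
      congr 1
      rw [mul_comm]
      congr 3
      ring
    · rw [hv, ENNReal.mul_rpow_of_ne_top ENNReal.ofReal_ne_top hωt,
        ENNReal.ofReal_rpow_of_pos (by positivity), ← Real.rpow_mul hρ.le, hb,
        mul_comm (ω ^ _)]
      congr 4
      ring
  have hsn : s + n / P = n / p := by rw [hP]; field_simp; ring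
  have hpt : ∀ x, ‖u x‖ₑ ^ P ≤ (a + b) ^ P * M ^ (P - p) * gagliardoDensity s p u x := by
    intro x
    have h := ennreal_le_of_forall_scale hat hbt ha0 hM0 hMt hs (by positivity : 0 < n / P)
      (hscale x)
    rw [hsn, ← ENNReal.rpow_mul] at h
    refine (ENNReal.rpow_le_rpow h hP0.le).trans_eq ?_
    rw [ENNReal.mul_rpow_of_nonneg _ _ hP0.le, ENNReal.mul_rpow_of_nonneg _ _ hP0.le,
      ← ENNReal.rpow_mul, ← ENNReal.rpow_mul,
      show p⁻¹ * (n / P / (n / p)) * P = 1 by field_simp,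
      show s / (n / p) * P = P - p by rw [hP]; field_simp; ring, ENNReal.rpow_one]
    ring
  have hint : M ^ P ≤ (a + b) ^ P * M ^ (P - p) * gagliardo s p u ^ p := by
    have hMP : M ^ P = ∫⁻ x, ‖u x‖ₑ ^ P := by
      rw [hM, eLpNorm_eq_lintegral_rpow_enorm_toReal (by simpa using hP0) ENNReal.ofReal_ne_top,
        ENNReal.toReal_ofReal hP0.le, ← ENNReal.rpow_mul, one_div, inv_mul_cancel₀ hP0.ne',
        ENNReal.rpow_one]
    rw [hMP, ← lintegral_gagliardoDensity hp0 hu, ← lintegral_const_mul _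
      (measurable_gagliardoDensity hu)]
    exact lintegral_mono hpt
  rw [← ENNReal.rpow_le_rpow_iff hp0, ENNReal.mul_rpow_of_nonneg _ _ hp0.le, ← ENNReal.rpow_mul,
    div_mul_cancel₀ _ hp0.ne']
  have hc0 : M ^ (P - p) ≠ 0 := by simp [hM0, hMt]
  have hct : M ^ (P - p) ≠ ∞ := by simp [hM0, hMt]
  rw [← ENNReal.mul_le_mul_iff_right hc0 hct, ← ENNReal.rpow_add _ _ hM0 hMt, sub_add_cancel]
  exact hint.trans_eq (by ring)

end

/-! ### Weighted integrals -/

section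

variable {α : Type*} [MeasurableSpace α] {μ : Measure α} {f k v : α → ℝ≥0∞} {q r P : ℝ}

/-- Where `k ≤ c v^τ`, the exponent `r = τ q + (1 - τ) P` is reached by interpolation between the
weighted `L^q` norm and the `L^P` norm. -/
theorem setLIntegral_mul_le_of_le_mul_rpow (hf : Measurable f) (hv : AEMeasurable v μ)
    {τ : ℝ} (hτ0 : 0 ≤ τ) (hτ1 : τ ≤ 1) (hq : 0 ≤ q) (hP : 0 ≤ P) (hr : r = q * τ + P * (1 - τ))
    {A : Set α} (hA : MeasurableSet A) {c : ℝ≥0∞} (hc : c ≠ ∞) (h : ∀ x ∈ A, k x ≤ c * v x ^ τ) :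
    ∫⁻ x in A, f x ^ r * k x ∂μ ≤
      c * ((∫⁻ x, f x ^ q * v x ∂μ) ^ τ * (∫⁻ x, f x ^ P ∂μ) ^ (1 - τ)) := by
  have hτ1' : 0 ≤ 1 - τ := sub_nonneg.2 hτ1
  calc ∫⁻ x in A, f x ^ r * k x ∂μ
      ≤ ∫⁻ x in A, c * ((f x ^ q * v x) ^ τ * (f x ^ P) ^ (1 - τ)) ∂μ := by
        refine setLIntegral_mono' hA fun x hx => ?_
        rw [ENNReal.mul_rpow_of_nonneg _ _ hτ0, ← ENNReal.rpow_mul, ← ENNReal.rpow_mul, hr,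
          ENNReal.rpow_add_of_nonneg _ _ (by positivity) (by positivity)]
        refine (mul_le_mul_right (h x hx) _).trans_eq (by ring)
    _ ≤ ∫⁻ x, c * ((f x ^ q * v x) ^ τ * (f x ^ P) ^ (1 - τ)) ∂μ := setLIntegral_le_lintegral _ _
    _ = c * ∫⁻ x, (f x ^ q * v x) ^ τ * (f x ^ P) ^ (1 - τ) ∂μ := lintegral_const_mul' _ _ hc
    _ ≤ _ := by
        gcongr
        exact ENNReal.lintegral_mul_norm_pow_le ((hf.pow_const q).aemeasurable.mul hv)
          (hf.pow_const P).aemeasurable hτ0 hτ1' (add_sub_cancel _ _)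

/-- Hölder's inequality with exponents `P / r` and `P / (P - r)`. -/
theorem setLIntegral_mul_le_holder (hf : Measurable f) (hk : AEMeasurable k μ)
    (hr : 0 < r) (hrP : r < P) (A : Set α) :
    ∫⁻ x in A, f x ^ r * k x ∂μ ≤
      (∫⁻ x, f x ^ P ∂μ) ^ (r / P) * (∫⁻ x in A, k x ^ (P / (P - r)) ∂μ) ^ (1 - r / P) := by
  have hP : 0 < P := hr.trans hrP
  have hPr : P - r ≠ 0 := (sub_pos.2 hrP).ne'
  have h := ENNReal.lintegral_mul_norm_pow_le (μ := μ.restrict A)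
    (hf.pow_const P).aemeasurable (hk.restrict.pow_const (P / (P - r)))
    (div_nonneg hr.le hP.le) (sub_nonneg.2 ((div_le_one hP).2 hrP.le)) (add_sub_cancel _ _)
  simp only [← ENNReal.rpow_mul, mul_div_cancel₀ _ hP.ne',
    show P / (P - r) * (1 - r / P) = 1 by field_simp, ENNReal.rpow_one] at h
  refine h.trans ?_
  gcongr
  exact Measure.restrict_le_self

end

section

variable {n : ℕ} {s p q r : ℝ}

theorem eLpNorm_weightMeasure_rpow (hr : 0 < r) {K : EuclideanSpace ℝ (Fin n) → ℝ}
    (hK : AEMeasurable K volume) {u : EuclideanSpace ℝ (Fin n) → ℝ} (hu : Continuous u) :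
    eLpNorm u (ENNReal.ofReal r) (weightMeasure K) ^ r =
      ∫⁻ x, ‖u x‖ₑ ^ r * ENNReal.ofReal (K x) := by
  have := hu.measurable
  rw [eLpNorm_eq_lintegral_rpow_enorm_toReal (by simpa using hr) ENNReal.ofReal_ne_top,
    ENNReal.toReal_ofReal hr.le, ← ENNReal.rpow_mul, one_div, inv_mul_cancel₀ hr.ne',
    ENNReal.rpow_one, weightMeasure,
    lintegral_withDensity_eq_lintegral_mul₀ hK.ennreal_ofReal
      (Measurable.aemeasurable (by fun_prop))]
  simp only [Pi.mul_apply, mul_comm]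

section

variable [Fact (1 ≤ p)] [Fact (1 ≤ q)] {V : EuclideanSpace ℝ (Fin n) → ℝ}

theorem eLpNorm_le_ofReal_norm (φ : TestSpace n s q p V) :
    eLpNorm φ (ENNReal.ofReal q) (weightMeasure V) ≤ ENNReal.ofReal ‖φ‖ := by
  rw [← ENNReal.ofReal_toReal φ.2.2.2.1.ne]
  exact ENNReal.ofReal_le_ofReal (le_add_of_nonneg_right ENNReal.toReal_nonneg)

theorem gagliardo_le_ofReal_norm (φ : TestSpace n s q p V) :
    gagliardo s p φ ≤ ENNReal.ofReal ‖φ‖ := by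
  rw [← ENNReal.ofReal_toReal φ.2.2.2.2.ne]
  exact ENNReal.ofReal_le_ofReal (le_add_of_nonneg_left ENNReal.toReal_nonneg)

theorem lintegral_weight_le (hV : AEMeasurable V volume) (φ : TestSpace n s q p V) :
    ∫⁻ x, ‖φ x‖ₑ ^ q * ENNReal.ofReal (V x) ≤ ENNReal.ofReal ‖φ‖ ^ q := by
  have hq : 0 < q := one_pos.trans_le (Fact.out : 1 ≤ q)
  rw [← eLpNorm_weightMeasure_rpow hq hV φ.2.1.continuous]
  exact ENNReal.rpow_le_rpow (eLpNorm_le_ofReal_norm φ) hq.le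

/-- The fractional Sobolev inequality for the norm of the test space. -/
theorem exists_lintegral_critExp_le (hs : 0 < s) (hsp : s * p < n) :
    ∃ C : ℝ≥0∞, C ≠ ∞ ∧ ∀ φ : TestSpace n s q p V,
      ∫⁻ x, ‖φ x‖ₑ ^ critExp n s p ≤ (C * ENNReal.ofReal ‖φ‖) ^ critExp n s p := by
  have hp : 1 ≤ p := Fact.out
  obtain ⟨C, hC, h⟩ := exists_eLpNorm_critExp_le (n := n) hs hp hsp
  have hP : 0 < critExp n s p := (one_pos.trans_le hp).trans (lt_critExp hs (by linarith) hsp)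
  refine ⟨C, hC, fun φ => ?_⟩
  have h1 := (h φ φ.2.1.continuous φ.2.2.1).trans
    (mul_le_mul_right (gagliardo_le_ofReal_norm φ) C)
  refine le_of_eq_of_le ?_ (ENNReal.rpow_le_rpow h1 hP.le)
  rw [eLpNorm_eq_lintegral_rpow_enorm_toReal (by simpa using hP) ENNReal.ofReal_ne_top,
    ENNReal.toReal_ofReal hP.le, ← ENNReal.rpow_mul, one_div, inv_mul_cancel₀ hP.ne',
    ENNReal.rpow_one]

end

/-! ### The weights at infinity -/

/-- Outside a set of finite measure, `K ≤ c V^τ`. -/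
theorem exists_measurable_superset_of_vanishes {V K : EuclideanSpace ℝ (Fin n) → ℝ} {τ : ℝ}
    (hVpos : ∀ x, 0 < V x) (hKV : VanishesAtInfinity fun x => K x * V x ^ (-τ))
    {c : ℝ} (hc : 0 < c) :
    ∃ Ω : Set (EuclideanSpace ℝ (Fin n)), MeasurableSet Ω ∧ volume Ω < ∞ ∧
      ∀ x ∈ Ωᶜ, ENNReal.ofReal (K x) ≤ ENNReal.ofReal c * ENNReal.ofReal (V x) ^ τ := by
  refine ⟨toMeasurable volume {x | c ≤ |K x * V x ^ (-τ)|}, measurableSet_toMeasurable _ _,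
    by rw [measure_toMeasurable]; exact hKV.2 c hc, fun x hx => ?_⟩
  have h1 : |K x * V x ^ (-τ)| < c := not_le.1 fun h => hx (subset_toMeasurable _ _ h)
  have h2 := (le_abs_self _).trans_lt h1
  rw [Real.rpow_neg (hVpos x).le, ← div_eq_mul_inv, div_lt_iff₀ (Real.rpow_pos_of_pos (hVpos x) _)]
    at h2
  rw [ENNReal.ofReal_rpow_of_pos (hVpos x), ← ENNReal.ofReal_mul hc.le]
  exact ENNReal.ofReal_le_ofReal h2.le

theorem setLIntegral_rpow_lt_top {K : EuclideanSpace ℝ (Fin n) → ℝ} (hKpos : ∀ x, 0 < K x)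
    {t : ℝ≥0∞} {σ : ℝ} (hσ : 0 < σ) (ht : ENNReal.ofReal σ ≤ t)
    {Ω : Set (EuclideanSpace ℝ (Fin n))} (hΩ : volume Ω < ∞) (hK : MemLp K t (volume.restrict Ω)) :
    ∫⁻ x in Ω, ENNReal.ofReal (K x) ^ σ < ∞ := by
  have : IsFiniteMeasure (volume.restrict Ω) := ⟨by simpa using hΩ⟩
  have h := lintegral_rpow_enorm_lt_top_of_eLpNorm_lt_top (by simpa using hσ)
    ENNReal.ofReal_ne_top (hK.mono_exponent ht).2
  simpa only [ENNReal.toReal_ofReal hσ.le, Real.enorm_of_nonneg (hKpos _).le] using h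

end

section

variable {n : ℕ} {s p q r τ : ℝ} [Fact (1 ≤ p)] [Fact (1 ≤ q)]
  {V K : EuclideanSpace ℝ (Fin n) → ℝ}

/-- Boundedness of the embedding on test functions: outside a set `Ω` of finite measure one has
`K ≤ V^τ`, and the `L^r(K)` norm is interpolated; on `Ω` Hölder's inequality is used. -/
theorem exists_lintegral_mul_le (hs : 0 < s) (hsp : s * p < n)
    (hqr : q ≤ r) (hr : r < critExp n s p)
    (hV : AEMeasurable V volume) (hK : AEMeasurable K volume) (hVpos : ∀ x, 0 < V x)
    (hKσ : ∀ Ω : Set (EuclideanSpace ℝ (Fin n)), MeasurableSet Ω → volume Ω < ∞ →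
      ∫⁻ x in Ω, ENNReal.ofReal (K x) ^ (critExp n s p / (critExp n s p - r)) < ∞)
    (hτ : τ = (critExp n s p - r) / (critExp n s p - q))
    (hKV : VanishesAtInfinity fun x => K x * V x ^ (-τ)) :
    ∃ C : ℝ≥0∞, C ≠ ∞ ∧ ∀ φ : TestSpace n s q p V,
      ∫⁻ x, ‖φ x‖ₑ ^ r * ENNReal.ofReal (K x) ≤ C * ENNReal.ofReal ‖φ‖ ^ r := by
  have hq : 1 ≤ q := Fact.out
  obtain ⟨C, hC, hSob⟩ := exists_lintegral_critExp_le (V := V) (q := q) hs hsp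
  set P := critExp n s p
  have hPr : 0 < P - r := sub_pos.2 hr
  have hPq : 0 < P - q := by linarith
  have hP : 0 < P := by linarith
  have hτ0 : 0 ≤ τ := by rw [hτ]; positivity
  have hτ1 : τ ≤ 1 := by rw [hτ, div_le_one hPq]; linarith
  have hrτ : r = q * τ + P * (1 - τ) := by rw [hτ]; field_simp; ring
  obtain ⟨Ω, hΩm, hΩ, hΩc⟩ := exists_measurable_superset_of_vanishes hVpos hKV one_pos
  set J := ∫⁻ x in Ω, ENNReal.ofReal (K x) ^ (P / (P - r))
  have hJ : J ≠ ∞ := (hKσ Ω hΩm hΩ).ne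
  have hrP1 : 0 ≤ 1 - r / P := sub_nonneg.2 ((div_le_one hP).2 hr.le)
  have hτ1' : 0 ≤ 1 - τ := sub_nonneg.2 hτ1
  have hr0 : 0 < r := by linarith
  refine ⟨C ^ r * J ^ (1 - r / P) + C ^ (P * (1 - τ)), by finiteness, fun φ => ?_⟩
  have hφ : Measurable fun x => ‖φ x‖ₑ := by
    have := φ.2.1.continuous.measurable
    fun_prop
  rw [← lintegral_add_compl _ hΩm, add_mul]
  refine add_le_add ?_ ?_
  · refine (setLIntegral_mul_le_holder hφ hK.ennreal_ofReal hr0 hr Ω).trans ?_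
    calc _ ≤ ((C * ENNReal.ofReal ‖φ‖) ^ P) ^ (r / P) * J ^ (1 - r / P) := by
          gcongr
          exact hSob φ
      _ = _ := by
          rw [← ENNReal.rpow_mul, mul_div_cancel₀ _ hP.ne', ENNReal.mul_rpow_of_nonneg _ _ hr0.le]
          ring
  · refine (setLIntegral_mul_le_of_le_mul_rpow hφ hV.ennreal_ofReal hτ0 hτ1 (by linarith) hP.le
      hrτ hΩm.compl ENNReal.ofReal_ne_top hΩc).trans ?_
    calc _ ≤ ENNReal.ofReal 1 * ((ENNReal.ofReal ‖φ‖ ^ q) ^ τ *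
            ((C * ENNReal.ofReal ‖φ‖) ^ P) ^ (1 - τ)) := by
          gcongr
          · exact lintegral_weight_le hV φ
          · exact hSob φ
      _ = _ := by
          rw [← ENNReal.rpow_mul, ← ENNReal.rpow_mul,
            ENNReal.mul_rpow_of_nonneg _ _ (by positivity), ENNReal.ofReal_one, one_mul]
          have hsplit : ENNReal.ofReal ‖φ‖ ^ r =
              ENNReal.ofReal ‖φ‖ ^ (q * τ) * ENNReal.ofReal ‖φ‖ ^ (P * (1 - τ)) := by
            rw [← ENNReal.rpow_add_of_nonneg _ _ (by positivity) (by positivity), ← hrτ]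
          rw [hsplit]
          ring

/-! ### Control of the weighted norm by finitely many averages -/

theorem setLIntegral_lt_top_of_rpow {f : EuclideanSpace ℝ (Fin n) → ℝ≥0∞} {σ : ℝ} (hσ : 1 ≤ σ)
    {Ω : Set (EuclideanSpace ℝ (Fin n))} (hΩ : volume Ω < ∞) (hf : AEMeasurable f volume)
    (h : ∫⁻ x in Ω, f x ^ σ < ∞) : ∫⁻ x in Ω, f x < ∞ := by
  have h1 := rpow_lintegral_le (μ := volume.restrict Ω) hσ hf.restrict
  rw [Measure.restrict_apply_univ] at h1
  have h2 := h1.trans_lt (ENNReal.mul_lt_top h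
    (ENNReal.rpow_lt_top_of_nonneg (sub_nonneg.2 hσ) hΩ.ne))
  exact (ENNReal.rpow_lt_top_iff_of_pos (by linarith)).1 h2

theorem exists_rpow_mul_lt {a e : ℝ≥0∞} (ha : a ≠ ∞) (he : e ≠ 0) {α : ℝ} (hα : 0 < α) :
    ∃ x : ℝ, 0 < x ∧ ENNReal.ofReal (x ^ α) * a < e := by
  obtain ⟨m, hm, h⟩ := ENNReal.exists_nnreal_pos_mul_lt ha he
  refine ⟨(m : ℝ) ^ α⁻¹, by positivity, ?_⟩
  rw [← Real.rpow_mul m.coe_nonneg, inv_mul_cancel₀ hα.ne', Real.rpow_one, ENNReal.ofReal_coe_nnreal]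
  exact h

/-- A set of finite measure is covered, up to small measure, by finitely many balls of a given
radius with centres in a fixed dense sequence. -/
theorem exists_measure_diff_iUnion_ball_lt {Ω : Set (EuclideanSpace ℝ (Fin n))}
    (hΩm : MeasurableSet Ω) (hΩ : volume Ω < ∞) {ρ : ℝ} (hρ : 0 < ρ) {e : ℝ≥0∞} (he : e ≠ 0) :
    ∃ N : ℕ, volume (Ω \ ⋃ i < N, Metric.ball
      (TopologicalSpace.denseSeq (EuclideanSpace ℝ (Fin n)) i) ρ) < e := by
  set S : ℕ → Set (EuclideanSpace ℝ (Fin n)) := fun N =>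
    Ω \ ⋃ i < N, Metric.ball (TopologicalSpace.denseSeq (EuclideanSpace ℝ (Fin n)) i) ρ with hS
  have hmono : Antitone S := fun a b hab => Set.sdiff_subset_sdiff_right
    (Set.biUnion_subset_biUnion_left fun i (hi : i < a) => hi.trans_le hab)
  have hlim := tendsto_measure_iInter_atTop (μ := volume) (s := S)
    (fun N => (hΩm.diff (MeasurableSet.biUnion (Set.to_countable _)
      fun i _ => measurableSet_ball)).nullMeasurableSet) hmono
    ⟨0, ne_top_of_le_ne_top hΩ.ne (measure_mono Set.sdiff_subset)⟩
  have hempty : ⋂ N, S N = ∅ := by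
    refine Set.eq_empty_of_forall_notMem fun x hx => ?_
    obtain ⟨i, hi⟩ := (TopologicalSpace.denseRange_denseSeq
      (EuclideanSpace ℝ (Fin n))).exists_dist_lt x hρ
    exact (Set.mem_iInter.1 hx (i + 1)).2 (Set.mem_biUnion (Nat.lt_succ_self i) hi)
  rw [hempty, measure_empty] at hlim
  exact ((tendsto_order.1 hlim).2 e (pos_iff_ne_zero.2 he)).exists

/-- On the ball of radius `4` of the test space, which holds the differences of elements of the ball
of radius `2`, the norm of `L^r(K)` is small as soon as finitely
many averages are small. Outside a set `Ω` of finite measure the integral is small since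
`K V^(-τ)` vanishes at infinity; inside `Ω` it is small where `|φ| ≤ 2 η`, and the rest of `Ω` has
small measure, because there the Gagliardo density is large, or the finitely many balls do not cover
it. -/
theorem exists_averages_control (hs : 0 < s) (hsp : s * p < n)
    (hqr : q ≤ r) (hr : r < critExp n s p)
    (hV : AEMeasurable V volume) (hK : AEMeasurable K volume) (hVpos : ∀ x, 0 < V x)
    (hKσ : ∀ Ω : Set (EuclideanSpace ℝ (Fin n)), MeasurableSet Ω → volume Ω < ∞ →
      ∫⁻ x in Ω, ENNReal.ofReal (K x) ^ (critExp n s p / (critExp n s p - r)) < ∞)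
    (hτ : τ = (critExp n s p - r) / (critExp n s p - q))
    (hKV : VanishesAtInfinity fun x => K x * V x ^ (-τ)) {ε : ℝ≥0∞} (hε : ε ≠ 0) :
    ∃ (N : ℕ) (ρ δ : ℝ), 0 < ρ ∧ 0 < δ ∧ ∀ φ : TestSpace n s q p V, ‖φ‖ ≤ 4 →
      (∀ i < N, |⨍ y in Metric.ball (TopologicalSpace.denseSeq (EuclideanSpace ℝ (Fin n)) i) ρ,
        φ y| ≤ δ) →
      ∫⁻ x, ‖φ x‖ₑ ^ r * ENNReal.ofReal (K x) ≤ ε := by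
  have hq : 1 ≤ q := Fact.out
  have hp : 1 ≤ p := Fact.out
  have hp0 : 0 < p := by linarith
  obtain ⟨C, hC, hSob⟩ := exists_lintegral_critExp_le (V := V) (q := q) hs hsp
  set P := critExp n s p
  have hPr : 0 < P - r := sub_pos.2 hr
  have hPq : 0 < P - q := by linarith
  have hP : 0 < P := by linarith
  have hr0 : 0 < r := by linarith
  have hτ0 : 0 ≤ τ := by rw [hτ]; positivity
  have hτ1 : τ ≤ 1 := by rw [hτ, div_le_one hPq]; linarith
  have hτ1' : 0 ≤ 1 - τ := sub_nonneg.2 hτ1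
  have hrτ : r = q * τ + P * (1 - τ) := by rw [hτ]; field_simp; ring
  have hrP1 : 0 < 1 - r / P := sub_pos.2 ((div_lt_one hP).2 hr)
  have hε3 : ε / 3 ≠ 0 := (ENNReal.div_pos hε (by simp)).ne'
  set B := ENNReal.ofReal 4
  have hB : B ≠ ∞ := ENNReal.ofReal_ne_top
  -- `c` makes the integral outside `Ω` small
  obtain ⟨c, hc, hcε⟩ := exists_rpow_mul_lt
    (a := (B ^ q) ^ τ * ((C * B) ^ P) ^ (1 - τ)) (by finiteness) hε3 one_pos
  rw [Real.rpow_one] at hcε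
  obtain ⟨Ω, hΩm, hΩ, hΩc⟩ := exists_measurable_superset_of_vanishes hVpos hKV hc
  have hJ := hKσ Ω hΩm hΩ
  have hκ : ∫⁻ x in Ω, ENNReal.ofReal (K x) < ∞ :=
    setLIntegral_lt_top_of_rpow ((one_le_div hPr).2 (by linarith)) hΩ hK.ennreal_ofReal hJ
  -- `η` makes the integral over `{|φ| ≤ 2 η} ∩ Ω` small
  obtain ⟨η₂, hη₂, hηε⟩ := exists_rpow_mul_lt hκ.ne hε3 hr0
  obtain ⟨η, hη, rfl⟩ : ∃ η : ℝ, 0 < η ∧ η₂ = 2 * η := ⟨η₂ / 2, by positivity, by ring⟩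
  -- `d` is such that the integral over subsets of `Ω` of measure less than `d` is small
  obtain ⟨e, he, heε⟩ := exists_rpow_mul_lt (a := (C * B) ^ r) (by finiteness) hε3 hrP1
  obtain ⟨d, hd, hdK⟩ := exists_pos_setLIntegral_lt_of_measure_lt (μ := volume.restrict Ω) hJ.ne
    (ε := ENNReal.ofReal e) (by simpa using he)
  have hd2 : d / 2 ≠ 0 := (ENNReal.div_pos hd.ne' (by simp)).ne'
  set ω := volume (Metric.ball (0 : EuclideanSpace ℝ (Fin n)) 1)
  have hω0 : ω ≠ 0 := (Metric.measure_ball_pos _ _ one_pos).ne'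
  have hωt : ω ≠ ∞ := measure_ball_lt_top.ne
  have hηp0 : ENNReal.ofReal (η ^ p) ≠ 0 := by
    simpa using Real.rpow_pos_of_pos hη p
  -- at scale `ρ`, functions are close to their averages off a set of small measure
  obtain ⟨ρ, hρ, hρd⟩ := exists_rpow_mul_lt
    (a := ENNReal.ofReal (2 ^ ((n : ℝ) + s * p)) / ω * B ^ p / ENNReal.ofReal (η ^ p))
    (by finiteness) hd2 (by positivity : 0 < s * p)
  obtain ⟨N, hN⟩ := exists_measure_diff_iUnion_ball_lt hΩm hΩ hρ hd2
  refine ⟨N, ρ, η, hρ, hη, fun φ hφB hφ => ?_⟩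
  have hφc : Continuous φ := φ.2.1.continuous
  have hφm : Measurable fun x => ‖φ x‖ₑ := by
    have := hφc.measurable
    fun_prop
  have hB' : ENNReal.ofReal ‖φ‖ ≤ B := ENNReal.ofReal_le_ofReal hφB
  have hIP : ∫⁻ x, ‖φ x‖ₑ ^ P ≤ (C * B) ^ P :=
    (hSob φ).trans (by gcongr)
  have hIq : ∫⁻ x, ‖φ x‖ₑ ^ q * ENNReal.ofReal (V x) ≤ B ^ q :=
    (lintegral_weight_le hV φ).trans (by gcongr)
  set A : Set (EuclideanSpace ℝ (Fin n)) := {x | ENNReal.ofReal (2 * η) < ‖φ x‖ₑ} ∩ Ω with hA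
  have hAm : MeasurableSet A := (measurableSet_lt measurable_const hφm).inter hΩm
  set κ : ℝ≥0∞ := ENNReal.ofReal ((2 * ρ) ^ ((n : ℝ) + s * p)) /
    (ENNReal.ofReal (ρ ^ (n : ℝ)) * ω) with hκdef
  have hκeq : κ = ENNReal.ofReal (ρ ^ (s * p)) * (ENNReal.ofReal (2 ^ ((n : ℝ) + s * p)) / ω) := by
    rw [hκdef, div_eq_mul_inv, ENNReal.mul_inv (Or.inr hωt) (Or.inr hω0), ← mul_assoc,
      ← ENNReal.ofReal_inv_of_pos (by positivity), ← ENNReal.ofReal_mul (by positivity),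
      Real.mul_rpow two_pos.le hρ.le, Real.rpow_add hρ,
      show (2 : ℝ) ^ ((n : ℝ) + s * p) * (ρ ^ (n : ℝ) * ρ ^ (s * p)) * (ρ ^ (n : ℝ))⁻¹
        = ρ ^ (s * p) * 2 ^ ((n : ℝ) + s * p) by field_simp,
      ENNReal.ofReal_mul (by positivity), div_eq_mul_inv, mul_assoc]
  have hκt : κ ≠ ∞ := by rw [hκeq]; finiteness
  set D : Set (EuclideanSpace ℝ (Fin n)) :=
    {x | ENNReal.ofReal (η ^ p) ≤ κ * gagliardoDensity s p φ x}
  have hD : volume D < d / 2 := by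
    refine (meas_ge_le_lintegral_div ((measurable_gagliardoDensity hφc).const_mul κ).aemeasurable
      hηp0 ENNReal.ofReal_ne_top).trans_lt (lt_of_le_of_lt ?_ hρd)
    rw [lintegral_const_mul' _ _ hκt, lintegral_gagliardoDensity hp0 hφc, hκeq]
    calc _ ≤ ENNReal.ofReal (ρ ^ (s * p)) * (ENNReal.ofReal (2 ^ ((n : ℝ) + s * p)) / ω) * B ^ p /
          ENNReal.ofReal (η ^ p) := by
          gcongr
          exact (gagliardo_le_ofReal_norm φ).trans hB'
      _ = _ := by simp only [div_eq_mul_inv]; ring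
  have hsub : A ⊆ (Ω \ ⋃ i < N, Metric.ball
      (TopologicalSpace.denseSeq (EuclideanSpace ℝ (Fin n)) i) ρ) ∪ D := by
    rintro x ⟨hx, hxΩ⟩
    by_cases hxU : x ∈ ⋃ i < N, Metric.ball
      (TopologicalSpace.denseSeq (EuclideanSpace ℝ (Fin n)) i) ρ
    swap
    · exact Or.inl ⟨hxΩ, hxU⟩
    right
    simp only [Set.mem_iUnion] at hxU
    obtain ⟨i, hi, hxi⟩ := hxU
    have h := enorm_sub_setAverage_rpow_le hp hs.le hφc measurableSet_ball
      (Metric.measure_ball_pos _ (TopologicalSpace.denseSeq (EuclideanSpace ℝ (Fin n)) i) hρ).ne'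
      measure_ball_lt_top.ne (integrableOn_ball hφc _ ρ) x (d := 2 * ρ) (fun y hy => by
        rw [← dist_eq_norm]
        have := dist_triangle_right x y
          (TopologicalSpace.denseSeq (EuclideanSpace ℝ (Fin n)) i)
        have h1 := Metric.mem_ball.1 hxi
        have h2 := Metric.mem_ball.1 hy
        linarith)
    rw [volume_ball_eq _ hρ] at h
    refine le_trans ?_ h
    have hm := hφ i hi
    rw [← ENNReal.ofReal_rpow_of_pos hη]
    refine ENNReal.rpow_le_rpow ?_ hp0.le
    change ENNReal.ofReal (2 * η) < ‖φ x‖ₑ at hx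
    rw [← ofReal_norm, ENNReal.ofReal_lt_ofReal_iff_of_nonneg (by positivity), Real.norm_eq_abs] at hx
    rw [← ofReal_norm, Real.norm_eq_abs]
    refine ENNReal.ofReal_le_ofReal ?_
    have := abs_sub_abs_le_abs_sub (φ x) (⨍ y in Metric.ball
      (TopologicalSpace.denseSeq (EuclideanSpace ℝ (Fin n)) i) ρ, φ y)
    linarith
  have hdt : d / 2 + d / 2 = d := ENNReal.add_halves d
  have hAd : (volume.restrict Ω) A < d := by
    refine (Measure.restrict_apply_le _ _).trans_lt ?_
    refine (measure_mono hsub).trans_lt ((measure_union_le _ _).trans_lt ?_)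
    rw [← hdt]
    exact ENNReal.add_lt_add hN hD
  have hAK := hdK A hAd
  rw [Measure.restrict_restrict_of_subset Set.inter_subset_right] at hAK
  have hcover : (Set.univ : Set (EuclideanSpace ℝ (Fin n))) = A ∪ ((Ω \ A) ∪ Ωᶜ) := by
    rw [← Set.union_assoc, Set.union_sdiff_cancel Set.inter_subset_right, Set.union_compl_self]
  rw [← setLIntegral_univ, hcover]
  refine (lintegral_union_le _ _ _).trans ?_
  rw [← ENNReal.add_thirds ε, add_assoc]
  refine add_le_add ?_ ((lintegral_union_le _ _ _).trans (add_le_add ?_ ?_))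
  · refine (setLIntegral_mul_le_holder hφm hK.ennreal_ofReal hr0 hr A).trans (le_trans ?_ heε.le)
    rw [mul_comm, ← ENNReal.ofReal_rpow_of_pos he]
    refine mul_le_mul' (ENNReal.rpow_le_rpow hAK.le hrP1.le) ?_
    refine (ENNReal.rpow_le_rpow hIP (by positivity)).trans_eq ?_
    rw [← ENNReal.rpow_mul, mul_div_cancel₀ _ hP.ne']
  · refine le_trans ?_ hηε.le
    rw [← lintegral_const_mul' _ _ ENNReal.ofReal_ne_top]
    refine (setLIntegral_mono' (hΩm.diff hAm) fun x hx => ?_).trans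
      (lintegral_mono_set Set.sdiff_subset)
    have : ‖φ x‖ₑ ≤ ENNReal.ofReal (2 * η) := not_lt.1 fun h => hx.2 ⟨h, hx.1⟩
    rw [← ENNReal.ofReal_rpow_of_pos hη₂]
    gcongr
  · refine (setLIntegral_mul_le_of_le_mul_rpow hφm hV.ennreal_ofReal hτ0 hτ1 (by linarith) hP.le
      hrτ hΩm.compl ENNReal.ofReal_ne_top hΩc).trans (le_trans ?_ hcε.le)
    gcongr

end

/-! ### The embedding of the test space -/

section

variable {n : ℕ} {s p q r : ℝ} [Fact (1 ≤ p)] [Fact (1 ≤ q)]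
  {V K : EuclideanSpace ℝ (Fin n) → ℝ}

theorem memLp_of_le_mul_norm {C : ℝ≥0∞} (hC : C ≠ ∞)
    (h : ∀ φ : TestSpace n s q p V,
      eLpNorm φ (ENNReal.ofReal r) (weightMeasure K) ≤ C * ENNReal.ofReal ‖φ‖)
    (φ : TestSpace n s q p V) : MemLp φ (ENNReal.ofReal r) (weightMeasure K) :=
  ⟨φ.2.1.continuous.aestronglyMeasurable, (h φ).trans_lt (by finiteness)⟩

variable [Fact (1 ≤ r)]

/-- The identity on test functions, as a continuous linear map into `L^r(K)`, given a bound for the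
norm of `L^r(K)` by the norm of the test space. -/
noncomputable def testToLp {C : ℝ≥0∞} (hC : C ≠ ∞)
    (h : ∀ φ : TestSpace n s q p V,
      eLpNorm φ (ENNReal.ofReal r) (weightMeasure K) ≤ C * ENNReal.ofReal ‖φ‖) :
    TestSpace n s q p V →L[ℝ] WeightedLp r K :=
  LinearMap.mkContinuous
    { toFun := fun φ => (memLp_of_le_mul_norm hC h φ).toLp φ
      map_add' := fun _ _ => rfl
      map_smul' := fun _ _ => rfl } C.toReal fun φ => by
    change ‖(memLp_of_le_mul_norm hC h φ).toLp φ‖ ≤ _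
    rw [Lp.norm_toLp]
    refine (ENNReal.toReal_mono (by finiteness) (h φ)).trans_eq ?_
    rw [ENNReal.toReal_mul, ENNReal.toReal_ofReal (norm_nonneg _)]

variable {C : ℝ≥0∞} (hC : C ≠ ∞) (h : ∀ φ : TestSpace n s q p V,
      eLpNorm φ (ENNReal.ofReal r) (weightMeasure K) ≤ C * ENNReal.ofReal ‖φ‖)

theorem coeFn_testToLp (φ : TestSpace n s q p V) : testToLp hC h φ =ᵐ[weightMeasure K] φ :=
  (memLp_of_le_mul_norm hC h φ).coeFn_toLp

theorem norm_testToLp (φ : TestSpace n s q p V) :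
    ‖testToLp hC h φ‖ = (eLpNorm φ (ENNReal.ofReal r) (weightMeasure K)).toReal :=
  Lp.norm_toLp _ (memLp_of_le_mul_norm hC h φ)

theorem volume_absolutelyContinuous_weightMeasure (hK : AEMeasurable K volume)
    (hKpos : ∀ x, 0 < K x) : volume ≪ weightMeasure K :=
  withDensity_absolutelyContinuous' hK.ennreal_ofReal
    (Filter.Eventually.of_forall fun x => by simpa using hKpos x)

/-! ### Injectivity -/

/-- A sequence of test functions that is Cauchy for the norm and tends to zero almost everywhere
tends to zero for the norm, by Fatou's lemma. -/
theorem tendsto_norm_zero_of_cauchySeq {ψ : ℕ → TestSpace n s q p V} (hψ : CauchySeq ψ)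
    (hae : ∀ᵐ x, Filter.Tendsto (fun k => ψ k x) Filter.atTop (nhds 0)) :
    Filter.Tendsto (fun k => ‖ψ k‖) Filter.atTop (nhds 0) := by
  rw [Metric.tendsto_atTop]
  intro ε hε
  obtain ⟨N, hN⟩ := Metric.cauchySeq_iff.1 hψ (ε / 3) (by positivity)
  refine ⟨N, fun k hk => ?_⟩
  have hsmall : ∀ᶠ m in Filter.atTop, ENNReal.ofReal ‖ψ k - ψ m‖ ≤ ENNReal.ofReal (ε / 3) := by
    filter_upwards [Filter.eventually_ge_atTop N] with m hm
    have := hN k hk m hm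
    rw [dist_eq_norm] at this
    exact ENNReal.ofReal_le_ofReal this.le
  have h1 : eLpNorm (ψ k) (ENNReal.ofReal q) (weightMeasure V) ≤ ENNReal.ofReal (ε / 3) := by
    refine (Lp.eLpNorm_lim_le_liminf_eLpNorm
      (f := fun m => ((ψ k - ψ m : TestSpace n s q p V) : EuclideanSpace ℝ (Fin n) → ℝ))
      (fun m => (ψ k - ψ m).2.1.continuous.aestronglyMeasurable) _ ?_).trans ?_
    · filter_upwards [withDensity_absolutelyContinuous volume _ hae] with x hx
      have := tendsto_const_nhds (x := ψ k x) |>.sub hx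
      rwa [sub_zero] at this
    · refine (Filter.liminf_le_liminf ?_).trans_eq (Filter.liminf_const _)
      filter_upwards [hsmall] with m hm
      exact (eLpNorm_le_ofReal_norm _).trans hm
  have h2 : gagliardo s p (ψ k) ≤ ENNReal.ofReal (ε / 3) := by
    rw [gagliardo_eq_eLpNorm]
    refine (Lp.eLpNorm_lim_le_liminf_eLpNorm
      (f := fun m z => ((ψ k - ψ m : TestSpace n s q p V).1 z.1 -
        (ψ k - ψ m : TestSpace n s q p V).1 z.2) / ‖z.1 - z.2‖ ^ (((n : ℝ) + s * p) / p))
      (fun m => aestronglyMeasurable_quotient _ (ψ k - ψ m).2.1.continuous) _ ?_).trans ?_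
    · filter_upwards [Measure.quasiMeasurePreserving_fst.ae hae,
        Measure.quasiMeasurePreserving_snd.ae hae] with z hz1 hz2
      have e1 := tendsto_const_nhds (x := ψ k z.1) |>.sub hz1
      have e2 := tendsto_const_nhds (x := ψ k z.2) |>.sub hz2
      rw [sub_zero] at e1 e2
      exact (e1.sub e2).div_const _
    · refine (Filter.liminf_le_liminf ?_).trans_eq (Filter.liminf_const _)
      filter_upwards [hsmall] with m hm
      rw [← gagliardo_eq_eLpNorm]
      exact (gagliardo_le_ofReal_norm _).trans hm
  have h1' := ENNReal.toReal_le_of_le_ofReal (by positivity) h1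
  have h2' := ENNReal.toReal_le_of_le_ofReal (by positivity) h2
  rw [dist_zero_right, norm_norm, norm_def]
  linarith

/-- The continuous extension of `testToLp` to the completion is injective: if the image of a limit
of test functions vanishes, a subsequence tends to zero almost everywhere. -/
theorem injective_of_extends (hK : AEMeasurable K volume) (hKpos : ∀ x, 0 < K x)
    (ι : MSpace n s q p V →L[ℝ] WeightedLp r K)
    (hι : ∀ φ : TestSpace n s q p V, ι φ =ᵐ[weightMeasure K] φ) : Function.Injective ι := by
  refine (injective_iff_map_eq_zero ι).2 fun X hX => ?_
  obtain ⟨y, hy, hyX⟩ := mem_closure_iff_seq_limit.1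
    (UniformSpace.Completion.denseRange_coe (α := TestSpace n s q p V) X)
  choose φ hφ using hy
  obtain rfl : (fun k => (φ k : MSpace n s q p V)) = y := funext hφ
  have hlim := (ι.continuous.tendsto X).comp hyX
  rw [hX] at hlim
  obtain ⟨ns, hns, hae⟩ := (tendstoInMeasure_of_tendsto_Lp hlim).exists_seq_tendsto_ae
  have hψX := hyX.comp hns.tendsto_atTop
  have hcau : CauchySeq fun k => φ (ns k) := by
    refine Metric.cauchySeq_iff.2 fun ε hε => ?_
    obtain ⟨N, hN⟩ := Metric.cauchySeq_iff.1 hψX.cauchySeq ε hε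
    refine ⟨N, fun a ha b hb => ?_⟩
    have := hN a ha b hb
    rwa [Function.comp_apply, Function.comp_apply, UniformSpace.Completion.dist_eq] at this
  have hnorm := tendsto_norm_zero_of_cauchySeq hcau (by
    refine volume_absolutelyContinuous_weightMeasure hK hKpos ?_
    filter_upwards [hae, ae_all_iff.2 fun k => hι (φ (ns k)),
      Lp.coeFn_zero ℝ (ENNReal.ofReal r) (weightMeasure K)] with x hx hk h0
    rw [h0] at hx
    exact hx.congr fun k => hk k)
  have hX0 := hψX.norm
  simp only [Function.comp_apply, UniformSpace.Completion.norm_coe] at hX0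
  exact norm_eq_zero.1 (tendsto_nhds_unique hX0 hnorm)

/-! ### Compactness -/

theorem exists_abs_setAverage_ball_le (hs : 0 < s) (hsp : s * p < n) {ρ : ℝ} (hρ : 0 < ρ) :
    ∃ M : ℝ, ∀ φ : TestSpace n s q p V, ‖φ‖ ≤ 2 → ∀ x, |⨍ y in Metric.ball x ρ, φ y| ≤ M := by
  have hp : 1 ≤ p := Fact.out
  obtain ⟨C, hC, h⟩ := exists_eLpNorm_critExp_le (n := n) hs hp hsp
  have hpP := lt_critExp hs (by linarith) hsp
  set v := ENNReal.ofReal (ρ ^ (n : ℝ)) * volume (Metric.ball (0 : EuclideanSpace ℝ (Fin n)) 1)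
    with hv
  have hv0 : v ≠ 0 := by
    rw [hv, ← volume_ball_eq 0 hρ]
    exact (Metric.measure_ball_pos _ _ hρ).ne'
  have hvt : v ≠ ∞ := by
    rw [hv, ← volume_ball_eq 0 hρ]
    exact measure_ball_lt_top.ne
  have hMt : v ^ (-(critExp n s p)⁻¹) * (C * ENNReal.ofReal 2) ≠ ∞ :=
    ENNReal.mul_ne_top (by simp [hv0, hvt]) (by finiteness)
  refine ⟨(v ^ (-(critExp n s p)⁻¹) * (C * ENNReal.ofReal 2)).toReal, fun φ hφ x => ?_⟩
  have h1 := enorm_setAverage_le (P := critExp n s p) (by linarith)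
    (Metric.measure_ball_pos _ x hρ).ne' measure_ball_lt_top.ne φ.2.1.continuous
    (integrableOn_ball φ.2.1.continuous x ρ)
  rw [← Real.norm_eq_abs, ← toReal_enorm]
  refine ENNReal.toReal_mono hMt (h1.trans ?_)
  rw [volume_ball_eq x hρ]
  gcongr
  refine (h φ φ.2.1.continuous φ.2.2.1).trans ?_
  gcongr
  exact (gagliardo_le_ofReal_norm φ).trans (ENNReal.ofReal_le_ofReal hφ)

/-- If finitely many averages control the norm of `L^r(K)` on bounded sets, then the image of a ball
is totally bounded: it is discretised by rounding these averages. -/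
theorem totallyBounded_image_ball (hs : 0 < s) (hsp : s * p < n) (hK : AEMeasurable K volume)
    (hctrl : ∀ ε : ℝ≥0∞, ε ≠ 0 →
      ∃ (N : ℕ) (ρ δ : ℝ), 0 < ρ ∧ 0 < δ ∧ ∀ φ : TestSpace n s q p V, ‖φ‖ ≤ 4 →
      (∀ i < N, |⨍ y in Metric.ball (TopologicalSpace.denseSeq (EuclideanSpace ℝ (Fin n)) i) ρ,
        φ y| ≤ δ) →
      ∫⁻ x, ‖φ x‖ₑ ^ r * ENNReal.ofReal (K x) ≤ ε) :
    TotallyBounded (testToLp hC h '' Metric.ball 0 2) := by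
  have hr : 0 < r := one_pos.trans_le (Fact.out : 1 ≤ r)
  refine Metric.totallyBounded_of_finite_discretization fun ε hε => ?_
  obtain ⟨N, ρ, δ, hρ, hδ, hN⟩ := hctrl (ENNReal.ofReal ((ε / 2) ^ r))
    (by simpa using Real.rpow_pos_of_pos (half_pos hε) r)
  obtain ⟨M, hM⟩ := exists_abs_setAverage_ball_le (V := V) (q := q) hs hsp hρ
  choose g hg hgx using fun x : testToLp hC h '' Metric.ball 0 2 => x.2
  have hg2 : ∀ x, ‖g x‖ ≤ 2 := fun x => (mem_ball_zero_iff.1 (hg x)).le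
  let av : (testToLp hC h '' Metric.ball 0 2) → ℕ → ℝ := fun x i =>
    ⨍ y in Metric.ball (TopologicalSpace.denseSeq (EuclideanSpace ℝ (Fin n)) i) ρ, g x y
  have hav : ∀ x i, ⌊av x i / δ⌋ ∈ Finset.Icc ⌊-M / δ⌋ ⌊M / δ⌋ := fun x i => by
    have := abs_le.1 (hM (g x) (hg2 x) (TopologicalSpace.denseSeq (EuclideanSpace ℝ (Fin n)) i))
    rw [Finset.mem_Icc]
    constructor
    · exact Int.floor_le_floor (by gcongr; exact this.1)
    · exact Int.floor_le_floor (by gcongr; exact this.2)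
  refine ⟨Fin N → Finset.Icc ⌊-M / δ⌋ ⌊M / δ⌋, inferInstance,
    fun x i => ⟨⌊av x i / δ⌋, hav x i⟩, fun x y hxy => ?_⟩
  have hclose : ∀ i < N, |⨍ z in Metric.ball
      (TopologicalSpace.denseSeq (EuclideanSpace ℝ (Fin n)) i) ρ,
      (g x - g y : TestSpace n s q p V).1 z| ≤ δ := by
    intro i hi
    have h1 : ⌊av x i / δ⌋ = ⌊av y i / δ⌋ := congrArg Subtype.val (congrFun hxy ⟨i, hi⟩)
    have h2 := Int.abs_sub_lt_one_of_floor_eq_floor h1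
    rw [← sub_div, abs_div, abs_of_pos hδ, div_lt_one hδ] at h2
    have h3 : ⨍ z in Metric.ball (TopologicalSpace.denseSeq (EuclideanSpace ℝ (Fin n)) i) ρ,
        (g x - g y : TestSpace n s q p V).1 z = av x i - av y i := by
      have : (g x - g y : TestSpace n s q p V).1 = fun z => (g x).1 z - (g y).1 z := rfl
      simp only [av, setAverage_eq, this]
      rw [integral_sub (integrableOn_ball (g x).2.1.continuous _ ρ)
        (integrableOn_ball (g y).2.1.continuous _ ρ), smul_sub]
    rw [h3]
    exact h2.le
  have h4 := hN (g x - g y) ((norm_sub_le _ _).trans (by linarith [hg2 x, hg2 y])) hclose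
  rw [← eLpNorm_weightMeasure_rpow hr hK (g x - g y).2.1.continuous,
    ← ENNReal.ofReal_rpow_of_pos (half_pos hε), ENNReal.rpow_le_rpow_iff hr] at h4
  rw [← hgx x, ← hgx y, dist_eq_norm, ← map_sub, norm_testToLp]
  exact (ENNReal.toReal_le_of_le_ofReal (half_pos hε).le h4).trans_lt (half_lt_self hε)

/-- A continuous linear map on a completion is compact if it maps a ball of the original space to a
totally bounded set. -/
theorem isCompactOperator_of_totallyBounded {E F : Type*} [SeminormedAddCommGroup E]
    [NormedSpace ℝ E] [NormedAddCommGroup F] [NormedSpace ℝ F] [CompleteSpace F]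
    (ι : UniformSpace.Completion E →L[ℝ] F) {R : ℝ} (hR : 0 < R)
    (h : TotallyBounded ((fun x : E => ι x) '' Metric.ball 0 R)) : IsCompactOperator ι := by
  refine ⟨closure ((fun x : E => ι x) '' Metric.ball 0 R),
    h.closure.isCompact_of_isClosed isClosed_closure, ?_⟩
  refine Filter.mem_of_superset (Metric.ball_mem_nhds 0 hR) fun X hX => ?_
  have h1 := UniformSpace.Completion.denseRange_coe (α := E) |>.open_subset_closure_inter
    Metric.isOpen_ball hX
  refine map_mem_closure ι.continuous h1 ?_
  rintro _ ⟨hx, x, rfl⟩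
  refine ⟨x, ?_, rfl⟩
  rwa [mem_ball_zero_iff, UniformSpace.Completion.norm_coe, ← mem_ball_zero_iff] at hx

end

end FracSobolev

theorem theorem4 (n : ℕ) (hn : 2 ≤ n) (s p q r : ℝ)
    [Fact (1 ≤ p)] [Fact (1 ≤ q)] [Fact (1 ≤ r)]
    (hs0 : 0 < s) (hs1 : s < 1) (hsp : s * p < n)
    (hqr : q ≤ r) (hr : r < FracSobolev.critExp n s p)
    (V K : EuclideanSpace ℝ (Fin n) → ℝ)
    (hVmeas : AEMeasurable V volume) (hKmeas : AEMeasurable K volume)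
    (hVpos : ∀ x, 0 < V x) (hKpos : ∀ x, 0 < K x)
    (hVloc : ∀ D : Set (EuclideanSpace ℝ (Fin n)), IsCompact D →
      ∃ c : ℝ, 0 < c ∧ ∀ x ∈ D, c ≤ V x)
    (t : ℝ≥0∞)
    (ht : ENNReal.ofReal
      (FracSobolev.critExp n s p / (FracSobolev.critExp n s p - r)) < t)
    (hKt : ∀ Ω : Set (EuclideanSpace ℝ (Fin n)), MeasurableSet Ω → volume Ω < ∞ →
      MemLp K t (volume.restrict Ω))
    (τ : ℝ)
    (hτ : τ = (FracSobolev.critExp n s p - r) / (FracSobolev.critExp n s p - q))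
    (hKV : FracSobolev.VanishesAtInfinity fun x => K x * V x ^ (-τ)) :
    ∃ ι : FracSobolev.MSpace n s q p V →L[ℝ] FracSobolev.WeightedLp r K,
      (∀ φ : FracSobolev.TestSpace n s q p V,
        (ι (φ : FracSobolev.MSpace n s q p V) : EuclideanSpace ℝ (Fin n) → ℝ) =ᵐ[volume] φ) ∧
      Function.Injective ι ∧
      IsCompactOperator ι := by
  open FracSobolev in
  have hr0 : 0 < r := one_pos.trans_le (Fact.out : 1 ≤ r)
  have hKσ : ∀ Ω : Set (EuclideanSpace ℝ (Fin n)), MeasurableSet Ω → volume Ω < ∞ →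
      ∫⁻ x in Ω, ENNReal.ofReal (K x) ^ (critExp n s p / (critExp n s p - r)) < ∞ :=
    fun Ω hΩm hΩ => setLIntegral_rpow_lt_top hKpos
      (div_pos (hr0.trans hr) (sub_pos.2 hr)) ht.le hΩ (hKt Ω hΩm hΩ)
  obtain ⟨C, hC, hbd⟩ := exists_lintegral_mul_le (p := p) (q := q) hs0 hsp hqr hr hVmeas hKmeas
    hVpos hKσ hτ hKV
  have hC' : C ^ r⁻¹ ≠ ∞ := by finiteness
  have hemb : ∀ φ : TestSpace n s q p V,
      eLpNorm φ (ENNReal.ofReal r) (weightMeasure K) ≤ C ^ r⁻¹ * ENNReal.ofReal ‖φ‖ := fun φ => by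
    rw [← ENNReal.rpow_le_rpow_iff hr0, eLpNorm_weightMeasure_rpow hr0 hKmeas φ.2.1.continuous,
      ENNReal.mul_rpow_of_nonneg _ _ hr0.le, ← ENNReal.rpow_mul, inv_mul_cancel₀ hr0.ne',
      ENNReal.rpow_one]
    exact hbd φ
  set ι := (testToLp hC' hemb).extend
    (UniformSpace.Completion.toComplL : TestSpace n s q p V →L[ℝ] MSpace n s q p V)
  have hι : ∀ φ : TestSpace n s q p V, ι φ = testToLp hC' hemb φ := fun φ =>
    ContinuousLinearMap.extend_eq _ UniformSpace.Completion.denseRange_coe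
      (UniformSpace.Completion.isUniformInducing_coe _) φ
  have hιae : ∀ φ : TestSpace n s q p V, ι φ =ᵐ[weightMeasure K] φ := fun φ => by
    rw [hι]
    exact coeFn_testToLp hC' hemb φ
  refine ⟨ι, fun φ => volume_absolutelyContinuous_weightMeasure hKmeas hKpos (hιae φ),
    injective_of_extends hKmeas hKpos ι hιae, isCompactOperator_of_totallyBounded ι two_pos ?_⟩
  simp only [hι]
  exact totallyBounded_image_ball hC' hemb hs0 hsp hKmeas fun ε hε =>
    exists_averages_control hs0 hsp hqr hr hVmeas hKmeas hVpos hKσ hτ hKV hε
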